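/- Let $G$ be a finitely generated group and let $S$ be a finite symmetric set of generators of $G$, with associated left-invariant word metric $d_G$. Let $\mathbb K\in\{\mathbb R,\mathbb C\}$, and for $1\le p<\infty$ let $L_p=L_p([0,1];\mathbb K)$ with Lebesgue measure. For a Banach space $X$ over $\mathbb K$, a map $\psi:G\to X$ is called equivariant if there are a homomorphism $\pi$ from $G$ to the group of linear isometric automorphisms of $X$, a map $f:G\to X$ with $f(xy)=\pi(x)f(y)+f(x)$ for all $x,y\in G$, and a vector $v\in X$, such that $\psi(x)=\pi(x)v+f(x)$ for all $x\in G$. Let $\alpha^\#_X(G)\in[0,\infty]$ be the supremum of all $\alpha\ge 0$ for which there exist an equivariant Lipschitz map $\psi:(G,d_G)\to X$ and $c>0$ with $\|\psi(x)-\psi(y)\|\ge c\, d_G(x,y)^\alpha$ for all distinct $x,y\in G$, and write $\alpha^\#_p(G)=\alpha^\#_{L_p}(G)$. Then for every $p\in[1,\infty)$ we have $\alpha_p^\#(G)\ge \alpha_2^\#(G)$. -/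

import Mathlib

open MeasureTheory
open scoped ENNReal NNReal unitInterval

/-- The left-invariant word metric on `G` induced by the set of generators `S`: the graph distance
in the Cayley graph of `G`, in which `x` and `x * s` are adjacent for `s ∈ S`. -/
noncomputable def wordDist {G : Type*} [Group G] (S : Set G) (x y : G) : ℕ :=
  (SimpleGraph.mulCayley S).dist x y

/-- `f` is a `1`-cocycle with respect to the action `π` of `G` on `X` by linear isometric
automorphisms. -/
def IsOneCocycle (𝕜 : Type*) [RCLike 𝕜] {G : Type*} [Group G]
    {X : Type*} [NormedAddCommGroup X] [NormedSpace 𝕜 X]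
    (π : G →* (X ≃ₗᵢ[𝕜] X)) (f : G → X) : Prop :=
  ∀ x y : G, f (x * y) = π x (f y) + f x

/-- `ψ` is equivariant: it is the orbit map of a vector `v` under the affine isometric action
`w ↦ π x w + f x` of `G` on `X`. -/
def IsEquivariantMap (𝕜 : Type*) [RCLike 𝕜] {G : Type*} [Group G]
    {X : Type*} [NormedAddCommGroup X] [NormedSpace 𝕜 X] (ψ : G → X) : Prop :=
  ∃ (π : G →* (X ≃ₗᵢ[𝕜] X)) (f : G → X) (v : X),
    IsOneCocycle 𝕜 π f ∧ ∀ x : G, ψ x = π x v + f x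

/-- `ψ` is Lipschitz for the word metric, with compression at least `c * d ^ α` for some `c > 0`.
(For `x = y` and `α > 0` both sides of the lower bound vanish. Taking `x ≠ y` avoids the
convention `0 ^ 0 = 1`.) -/
def HasCompression {G : Type*} [Group G] (S : Set G)
    {X : Type*} [NormedAddCommGroup X] (ψ : G → X) (α : ℝ≥0) : Prop :=
  (∃ L : ℝ, ∀ x y : G, ‖ψ x - ψ y‖ ≤ L * (wordDist S x y : ℝ)) ∧
  ∃ c : ℝ, 0 < c ∧
    ∀ x y : G, x ≠ y → c * (wordDist S x y : ℝ) ^ (α : ℝ) ≤ ‖ψ x - ψ y‖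

/-- The equivariant compression exponent of `G` (with generators `S`) in the normed space `X`
over `𝕜`: the supremum in `[0, ∞]` of the `α ≥ 0` for which there is an equivariant Lipschitz map
`ψ : G → X` with compression at least `c * d ^ α`. -/
noncomputable def equivariantCompressionExponent (𝕜 : Type*) [RCLike 𝕜] {G : Type*} [Group G]
    (S : Set G) (X : Type*) [NormedAddCommGroup X] [NormedSpace 𝕜 X] : ℝ≥0∞ :=
  ⨆ α ∈ {α : ℝ≥0 | ∃ ψ : G → X, IsEquivariantMap 𝕜 ψ ∧ HasCompression S ψ α}, (α : ℝ≥0∞)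

/-- The exponent for the Banach space `L_p = L_p([0,1])` of `𝕜`-valued functions, with Lebesgue
measure on the unit interval. -/
noncomputable def lpEquivariantCompressionExponent (𝕜 : Type*) [RCLike 𝕜] {G : Type*} [Group G]
    (S : Set G) (p : ℝ≥0∞) [Fact (1 ≤ p)] : ℝ≥0∞ :=
  equivariantCompressionExponent 𝕜 S (Lp 𝕜 p (volume : Measure I))

/-! The Gaussian trick. On the Gaussian product space indexed by an orthonormal basis of a real
Hilbert space `H`, the process `isonormal` assigns to each `h` a centred Gaussian variable of
variance `‖h‖ ^ 2`. All L_p norms of such a variable are multiples of `‖h‖`, with a factor depending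
only on `p`, so up to scaling `H` sits isometrically in L_p. The law of the process depends only on
inner products. Hence every orthogonal `U` is induced by a measure preserving map of the Gaussian
space, which acts isometrically on L_p for every `p`.

For separable `H ≠ 0` the Gaussian space is an atomless standard Borel probability space, so its L_p
is that of the unit interval. This gives `exists_orthogonal_representation_Lp`. The embedding `T` is
only additive, `H` being taken as a real space, but the cocycle identity involves nothing but sums
and the action. Composing an equivariant map into L_2 with `T` therefore gives an equivariant map
into L_p with all distances scaled by one constant, and both compression bounds survive. -/

open ProbabilityTheory Filter Topology Set

/-! ### Atomless standard Borel probability spaces and the unit interval. -/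

section UnitInterval

/-- The cumulative distribution function, as a map to the unit interval. -/
noncomputable def cdfUnitInterval (ν : Measure ℝ) (x : ℝ) : I :=
  ⟨cdf ν x, cdf_nonneg ν x, cdf_le_one ν x⟩

lemma monotone_cdfUnitInterval (ν : Measure ℝ) : Monotone (cdfUnitInterval ν) :=
  fun _ _ h => monotone_cdf ν h

lemma continuous_cdf_of_nullSingletonClass (ν : Measure ℝ) [IsProbabilityMeasure ν]
    [NullSingletonClass ν] : Continuous (cdf ν) := by
  rw [continuous_iff_continuousAt]
  intro x
  have h : (cdf ν).measure {x} = 0 := by rw [measure_cdf]; exact measure_singleton x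
  rw [StieltjesFunction.measure_singleton, ENNReal.ofReal_eq_zero, sub_nonpos] at h
  rw [continuousAt_iff_continuous_left'_right',
    (monotone_cdf ν).continuousWithinAt_Iio_iff_leftLim_eq]
  exact ⟨le_antisymm ((monotone_cdf ν).leftLim_le le_rfl) h,
    ((cdf ν).right_continuous x).mono Ioi_subset_Ici_self⟩

lemma exists_cdf_eq (ν : Measure ℝ) [IsProbabilityMeasure ν]
    [NullSingletonClass ν] {t : ℝ} (h0 : 0 < t) (h1 : t < 1) : ∃ x, cdf ν x = t := by
  obtain ⟨a, ha⟩ := ((tendsto_cdf_atBot ν).eventually_lt_const h0).exists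
  obtain ⟨b, hb⟩ := ((tendsto_cdf_atTop ν).eventually_const_lt h1).exists
  exact mem_range_of_exists_le_of_exists_ge (continuous_cdf_of_nullSingletonClass ν)
    ⟨a, ha.le⟩ ⟨b, hb.le⟩

/-- The probability integral transform: a variable with continuous distribution function `F` makes
`F(X)` uniform. -/
lemma measurePreserving_cdfUnitInterval (ν : Measure ℝ) [IsProbabilityMeasure ν]
    [NullSingletonClass ν] : MeasurePreserving (cdfUnitInterval ν) ν volume := by
  have hm : Measurable (cdfUnitInterval ν) := (monotone_cdfUnitInterval ν).measurable
  refine ⟨hm, ?_⟩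
  have := Measure.isProbabilityMeasure_map (μ := ν) hm.aemeasurable
  refine Measure.ext_of_Iic _ _ fun t => ?_
  rw [Measure.map_apply hm measurableSet_Iic, unitInterval.volume_Iic]
  apply le_antisymm
  · rcases eq_or_lt_of_le t.2.2 with h1 | h1
    · rw [h1]; simpa using prob_le_one
    -- The distribution function may be constant to the right of a point where it equals `t`, so the
    -- bound goes through levels `c > t`.
    · refine le_of_forall_gt_imp_ge_of_dense fun c hc => ?_
      rcases le_or_gt 1 c with h | h
      · exact prob_le_one.trans h
      have hct : c ≠ ∞ := (h.trans ENNReal.one_lt_top).ne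
      have hc0 : (t : ℝ) < c.toReal := (ENNReal.ofReal_lt_iff_lt_toReal t.2.1 hct).1 hc
      obtain ⟨x, hx⟩ := exists_cdf_eq ν (t.2.1.trans_lt hc0)
        (by rw [← ENNReal.toReal_one]; exact (ENNReal.toReal_lt_toReal hct ENNReal.one_ne_top).2 h)
      calc ν (cdfUnitInterval ν ⁻¹' Iic t) ≤ ν (Iic x) := by
            refine measure_mono fun y hy => ?_
            by_contra hxy
            have h2 := monotone_cdf ν (not_le.1 hxy).le
            have h3 : cdf ν y ≤ t := hy
            linarith
        _ = c := by rw [← ofReal_cdf, hx, ENNReal.ofReal_toReal hct]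
  · rcases eq_or_lt_of_le t.2.1 with h0 | h0
    · rw [← h0]; simp
    rcases eq_or_lt_of_le t.2.2 with h1 | h1
    · have : cdfUnitInterval ν ⁻¹' Iic t = univ :=
        eq_univ_of_forall fun x => by
          change cdf ν x ≤ t
          rw [h1]; exact cdf_le_one ν x
      rw [this, h1]; simp
    · obtain ⟨x, hx⟩ := exists_cdf_eq ν h0 h1
      rw [← hx, ofReal_cdf]
      refine measure_mono fun y hy => ?_
      change cdf ν y ≤ t
      rw [← hx]
      exact monotone_cdf ν hy

/-- An atomless standard Borel probability space is isomorphic modulo null sets to the unit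
interval. -/
theorem exists_measurePreserving_unitInterval {Ω : Type*} [MeasurableSpace Ω]
    [StandardBorelSpace Ω] (μ : Measure Ω) [IsProbabilityMeasure μ] [NullSingletonClass μ] :
    ∃ (Φ : Ω → I) (Ψ : I → Ω), MeasurePreserving Φ μ volume ∧ MeasurePreserving Ψ volume μ ∧
      Ψ ∘ Φ =ᵐ[μ] id ∧ Φ ∘ Ψ =ᵐ[volume] id := by
  have hne : Nonempty Ω := nonempty_of_isProbabilityMeasure μ
  set e : Ω → ℝ := embeddingReal Ω
  have he : MeasurableEmbedding e := measurableEmbedding_embeddingReal Ω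
  set ν := μ.map e
  have : IsProbabilityMeasure ν := Measure.isProbabilityMeasure_map he.measurable.aemeasurable
  have : NullSingletonClass ν := ⟨fun x => by
    rw [Measure.map_apply he.measurable (measurableSet_singleton x)]
    exact (subsingleton_singleton.preimage he.injective).measure_zero μ⟩
  set F := cdfUnitInterval ν
  have hF : MeasurePreserving F ν volume := measurePreserving_cdfUnitInterval ν
  have hΦ : MeasurePreserving (F ∘ e) μ volume := hF.comp ⟨he.measurable, rfl⟩
  -- `F` fails to be injective only on intervals of constancy, each of which contains a rational.
  -- Removing the countably many fibres over the values `F q`, all null, makes `F ∘ e` injective.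
  set N : Set Ω := ⋃ q : ℚ, (F ∘ e) ⁻¹' {F q}
  have hNm : MeasurableSet N :=
    MeasurableSet.iUnion fun q => hΦ.measurable (measurableSet_singleton _)
  have hN : μ N = 0 := by
    refine measure_iUnion_null fun q => ?_
    rw [hΦ.measure_preimage (measurableSet_singleton _).nullMeasurableSet, measure_singleton]
  have key : ∀ x ∉ N, ∀ y, e x < e y → F (e x) ≠ F (e y) := by
    intro x hx y hxy hF
    obtain ⟨q, h1, h2⟩ := exists_rat_btwn hxy
    refine hx (mem_iUnion.2 ⟨q, ?_⟩)
    exact le_antisymm (monotone_cdfUnitInterval ν h1.le)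
      ((monotone_cdfUnitInterval ν h2.le).trans hF.ge)
  have hinj : Function.Injective (fun x : ↥Nᶜ => F (e x)) := by
    intro x y hxy
    rcases lt_trichotomy (e x) (e y) with h | h | h
    · exact (key x x.2 y h hxy).elim
    · exact Subtype.ext (he.injective h)
    · exact (key y y.2 x h hxy.symm).elim
  have := hNm.compl.standardBorel
  have hemb := (hΦ.measurable.comp (measurable_subtype_coe (p := (· ∈ Nᶜ)))).measurableEmbedding hinj
  obtain ⟨Ψ, hΨ, hΨF⟩ := hemb.exists_measurable_extend measurable_subtype_coe fun _ => hne
  have h1 : Ψ ∘ (F ∘ e) =ᵐ[μ] id := by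
    filter_upwards [compl_mem_ae_iff.2 hN] with x hx
    exact congrFun hΨF ⟨x, hx⟩
  refine ⟨F ∘ e, Ψ, hΦ, ⟨hΨ, ?_⟩, h1, ?_⟩
  · rw [← hΦ.map_eq, Measure.map_map hΨ hΦ.measurable, Measure.map_congr h1, Measure.map_id]
  -- Lebesgue measure is the image of `μ`, so it suffices to test the identity at points `F (e x)`,
  -- where it follows from `h1`.
  · rw [← hΦ.map_eq]
    have hms : MeasurableSet {x | ((F ∘ e) ∘ Ψ) x = id x} :=
      measurableSet_eq_fun (hΦ.measurable.comp hΨ) measurable_id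
    refine (ae_map_iff hΦ.measurable.aemeasurable hms).2 ?_
    filter_upwards [h1] with x hx
    exact congrArg (F ∘ e) hx

end UnitInterval

/-! ### The isonormal Gaussian process and its law. -/

section Gaussian

/-- The product of standard Gaussian measures on `ι → ℝ`. -/
noncomputable abbrev gaussianProduct (ι : Type*) : Measure (ι → ℝ) :=
  Measure.infinitePi fun _ => gaussianReal 0 1

variable {ι : Type*}

lemma measurePreserving_eval_gaussianProduct (i : ι) :
    MeasurePreserving (Function.eval i) (gaussianProduct ι) (gaussianReal 0 1) :=
  measurePreserving_eval_infinitePi (fun _ => gaussianReal 0 1) i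

lemma nullSingletonClass_gaussianProduct [Nonempty ι] :
    NullSingletonClass (gaussianProduct ι) := by
  have := nullSingletonClass_gaussianReal (μ := 0) (v := 1) one_ne_zero
  refine ⟨fun x => ?_⟩
  obtain ⟨i⟩ := ‹Nonempty ι›
  refine measure_mono_null (t := Function.eval i ⁻¹' {x i}) (fun y hy => by
    rw [mem_singleton_iff.1 hy]; rfl) ?_
  rw [(measurePreserving_eval_gaussianProduct i).measure_preimage
    (measurableSet_singleton _).nullMeasurableSet, measure_singleton]

lemma memLp_eval_gaussianProduct (i : ι) {q : ℝ≥0∞} (hq : q ≠ ∞) :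
    MemLp (fun ω : ι → ℝ => ω i) q (gaussianProduct ι) :=
  (memLp_id_gaussianReal' q hq).comp_measurePreserving (measurePreserving_eval_gaussianProduct i)

lemma iIndepFun_eval_gaussianProduct :
    iIndepFun (fun (i : ι) (ω : ι → ℝ) => ω i) (gaussianProduct ι) :=
  iIndepFun_infinitePi (X := fun _ x => x) fun _ => measurable_id

/-- A coordinate on the Gaussian product, as a square integrable function. -/
noncomputable def gaussianCoord (i : ι) : Lp ℝ 2 (gaussianProduct ι) :=
  (memLp_eval_gaussianProduct i ENNReal.ofNat_ne_top).toLp _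

lemma coeFn_gaussianCoord (i : ι) :
    gaussianCoord i =ᵐ[gaussianProduct ι] fun ω => ω i :=
  MemLp.coeFn_toLp _

lemma orthonormal_gaussianCoord : Orthonormal ℝ (gaussianCoord (ι := ι)) := by
  classical
  rw [orthonormal_iff_ite]
  intro i j
  have h : inner ℝ (gaussianCoord i) (gaussianCoord j)
      = ∫ ω : ι → ℝ, ω i * ω j ∂gaussianProduct ι := by
    rw [L2.inner_def]
    refine integral_congr_ae ?_
    filter_upwards [coeFn_gaussianCoord i, coeFn_gaussianCoord j] with ω h1 h2
    rw [h1, h2]; simp [mul_comm]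
  have hmean (i : ι) : ∫ ω : ι → ℝ, ω i ∂gaussianProduct ι = 0 := by
    have := integral_map (measurePreserving_eval_gaussianProduct i).aemeasurable
      (f := fun x : ℝ => x) aestronglyMeasurable_id
    rw [(measurePreserving_eval_gaussianProduct i).map_eq, integral_id_gaussianReal] at this
    exact this.symm
  rw [h]
  split_ifs with hij
  · subst hij
    have hv := variance_id_gaussianReal (μ := 0) (v := 1)
    rw [variance_eq_sub (memLp_id_gaussianReal' 2 ENNReal.ofNat_ne_top)] at hv
    simp only [id_eq, integral_id_gaussianReal] at hv
    rw [← (measurePreserving_eval_gaussianProduct i).map_eq, integral_map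
      (measurable_pi_apply i).aemeasurable (by fun_prop)] at hv
    simpa [pow_two] using hv
  · have := (iIndepFun_eval_gaussianProduct.indepFun hij).integral_fun_mul_eq_mul_integral
      (measurable_pi_apply i).aestronglyMeasurable (measurable_pi_apply j).aestronglyMeasurable
    rw [this, hmean, zero_mul]

variable {H : Type*} [NormedAddCommGroup H] [InnerProductSpace ℝ H]

lemma Orthonormal.norm_sq_sum_smul {κ : Type*} {v : κ → H} (hv : Orthonormal ℝ v)
    (s : Finset κ) (a : κ → ℝ) : ‖∑ k ∈ s, a k • v k‖ ^ 2 = ∑ k ∈ s, a k ^ 2 := by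
  rw [← real_inner_self_eq_norm_sq, hv.inner_sum]
  exact Finset.sum_congr rfl fun k _ => by simp [pow_two]

/-- The isonormal Gaussian process attached to a Hilbert basis. -/
noncomputable def isonormal (b : HilbertBasis ι ℝ H) : H →ₗᵢ[ℝ] Lp ℝ 2 (gaussianProduct ι) :=
  orthonormal_gaussianCoord.orthogonalFamily.linearIsometry.comp b.repr.toLinearIsometry

lemma isonormal_basis (b : HilbertBasis ι ℝ H) (i : ι) :
    isonormal b (b i) = gaussianCoord i := by
  classical
  change orthonormal_gaussianCoord.orthogonalFamily.linearIsometry (b.repr (b i)) = _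
  rw [b.repr_self, OrthogonalFamily.linearIsometry_apply_single,
    LinearIsometry.toSpanSingleton_apply, one_smul]

/-- The map is 1-Lipschitz, because `s ↦ exp(is)` is and the L_1 norm is at most the L_2 norm. It
carries the characteristic function from finite combinations of basis vectors to all of `H`. -/
lemma continuous_integral_cexp {Ω : Type*} [MeasurableSpace Ω] (μ : Measure Ω)
    [IsProbabilityMeasure μ] :
    Continuous fun g : Lp ℝ 2 μ => ∫ ω, Complex.exp (g ω * Complex.I) ∂μ := by
  have hint (g : Lp ℝ 2 μ) : Integrable (fun ω => Complex.exp (g ω * Complex.I)) μ := by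
    refine Integrable.of_bound (C := 1) ?_ (ae_of_all _ fun ω => ?_)
    · have := (Lp.stronglyMeasurable g).measurable
      exact Measurable.aestronglyMeasurable (by fun_prop)
    · rw [Complex.norm_exp_ofReal_mul_I]
  refine LipschitzWith.continuous (K := 1) (LipschitzWith.of_dist_le_mul fun g g' => ?_)
  rw [NNReal.coe_one, one_mul, dist_eq_norm, dist_eq_norm, ← integral_sub (hint g) (hint g')]
  have h2 : MemLp (fun ω => (g - g' : Lp ℝ 2 μ) ω) 2 μ := Lp.memLp (g - g')
  have h1 : MemLp (fun ω => (g - g' : Lp ℝ 2 μ) ω) 1 μ := h2.mono_exponent (by norm_num)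
  calc _ ≤ ∫ ω, ‖Complex.exp (g ω * Complex.I) - Complex.exp (g' ω * Complex.I)‖ ∂μ :=
        norm_integral_le_integral_norm _
    _ ≤ ∫ ω, ‖(g - g' : Lp ℝ 2 μ) ω‖ ∂μ := by
        refine integral_mono_ae ((hint g).sub (hint g')).norm
          (memLp_one_iff_integrable.1 h1).norm ?_
        filter_upwards [Lp.coeFn_sub g g'] with ω hω
        rw [hω, Pi.sub_apply]
        have : Complex.exp (g ω * Complex.I) - Complex.exp (g' ω * Complex.I)
            = Complex.exp (g' ω * Complex.I) *
              (Complex.exp (Complex.I * ((g ω - g' ω : ℝ) : ℂ)) - 1) := by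
          rw [mul_sub, ← Complex.exp_add, mul_one]
          congr 2
          push_cast; ring
        rw [this, norm_mul, Complex.norm_exp_ofReal_mul_I, one_mul]
        exact Real.norm_exp_I_mul_ofReal_sub_one_le
    _ = (eLpNorm (fun ω => (g - g' : Lp ℝ 2 μ) ω) 1 μ).toReal := by
        rw [integral_norm_eq_lintegral_enorm h1.1, eLpNorm_one_eq_lintegral_enorm]
    _ ≤ ‖g - g'‖ := by
        rw [Lp.norm_def]
        exact ENNReal.toReal_mono h2.2.ne
          (eLpNorm_le_eLpNorm_of_exponent_le (by norm_num) h2.1)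

lemma charFun_map_eq_integral_cexp {Ω : Type*} [MeasurableSpace Ω] {μ : Measure Ω}
    {X : Ω → ℝ} (hX : AEMeasurable X μ) (t : ℝ) :
    charFun (μ.map X) t = ∫ ω, Complex.exp ((t * X ω : ℝ) * Complex.I) ∂μ := by
  rw [charFun_apply_real, integral_map hX]
  · simp
  · exact Continuous.aestronglyMeasurable (by fun_prop)

lemma integral_cexp_isonormal_sum (b : HilbertBasis ι ℝ H) (s : Finset ι) (a : ι → ℝ) :
    ∫ ω, Complex.exp (isonormal b (∑ i ∈ s, a i • b i) ω * Complex.I) ∂gaussianProduct ι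
      = Complex.exp ((-(‖∑ i ∈ s, a i • b i‖ ^ 2 / 2) : ℝ)) := by
  have hae : isonormal b (∑ i ∈ s, a i • b i) =ᵐ[gaussianProduct ι]
      fun ω => ∑ i ∈ s, a i * ω i := by
    rw [map_sum]
    simp_rw [map_smul, isonormal_basis]
    have h1 : ∀ i ∈ s, (a i • gaussianCoord i : Lp ℝ 2 (gaussianProduct ι))
        =ᵐ[gaussianProduct ι] fun ω => a i * ω i := by
      intro i _
      filter_upwards [Lp.coeFn_smul (a i) (gaussianCoord i), coeFn_gaussianCoord i] with ω h1 h2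
      rw [h1, Pi.smul_apply, h2, smul_eq_mul]
    filter_upwards [Lp.coeFn_finsetSum s fun i => a i • gaussianCoord i,
      (Finset.eventually_all s).2 h1] with ω h2 h3
    rw [h2, Finset.sum_apply]
    exact Finset.sum_congr rfl h3
  have hind : iIndepFun (s.restrict fun (i : ι) (ω : ι → ℝ) => a i * ω i)
      (gaussianProduct ι) :=
    ((iIndepFun_eval_gaussianProduct (ι := ι)).comp (fun i x => a i * x)
      fun i => by fun_prop).restrict s
  have h := congrFun (hind.charFun_map_fun_finsetSum_eq_prod
    fun i _ => Measurable.aemeasurable (by fun_prop)) 1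
  rw [charFun_map_eq_integral_cexp (Measurable.aemeasurable (by fun_prop))] at h
  have hlaw (i : ι) : (gaussianProduct ι).map (fun ω => a i * ω i)
      = gaussianReal 0 (.mk ((a i) ^ 2) (sq_nonneg _)) := by
    have := gaussianReal_map_const_mul (μ := 0) (v := 1) (a i)
    rw [mul_zero, mul_one, ← (measurePreserving_eval_gaussianProduct i).map_eq,
      Measure.map_map (measurable_const_mul (a i))
        (measurePreserving_eval_gaussianProduct i).measurable] at this
    exact this
  rw [integral_congr_ae (g := fun ω => Complex.exp ((1 * ∑ i ∈ s, a i * ω i : ℝ) * Complex.I)), h]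
  · rw [Finset.prod_apply]
    simp_rw [hlaw, charFun_gaussianReal]
    rw [← Complex.exp_sum, b.orthonormal.norm_sq_sum_smul]
    congr 1
    push_cast
    rw [Finset.sum_div, ← Finset.sum_neg_distrib]
    refine Finset.sum_congr rfl fun i _ => ?_
    simp
  · filter_upwards [hae] with ω hω
    rw [hω, one_mul]

lemma integral_cexp_isonormal (b : HilbertBasis ι ℝ H) (h : H) :
    ∫ ω, Complex.exp (isonormal b h ω * Complex.I) ∂gaussianProduct ι
      = Complex.exp ((-(‖h‖ ^ 2 / 2) : ℝ)) := by
  have hs := b.hasSum_repr h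
  have h1 := ((continuous_integral_cexp (gaussianProduct ι)).comp
    (isonormal b).continuous).continuousAt.tendsto.comp hs
  have h2 : Continuous fun x : H => Complex.exp ((-(‖x‖ ^ 2 / 2) : ℝ)) := by fun_prop
  refine tendsto_nhds_unique h1 ((h2.tendsto h).comp hs |>.congr fun s => ?_)
  exact (integral_cexp_isonormal_sum b s _).symm

lemma aemeasurable_isonormal (b : HilbertBasis ι ℝ H) (h : H) :
    AEMeasurable (isonormal b h) (gaussianProduct ι) :=
  (Lp.stronglyMeasurable _).measurable.aemeasurable

lemma charFun_map_isonormal (b : HilbertBasis ι ℝ H) (h : H) (t : ℝ) :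
    charFun ((gaussianProduct ι).map (isonormal b h)) t
      = Complex.exp ((-(t ^ 2 * ‖h‖ ^ 2 / 2) : ℝ)) := by
  rw [charFun_map_eq_integral_cexp (aemeasurable_isonormal b h)]
  have := integral_cexp_isonormal b (t • h)
  rw [norm_smul, mul_pow, Real.norm_eq_abs, sq_abs] at this
  rw [← this]
  refine integral_congr_ae ?_
  rw [map_smul]
  filter_upwards [Lp.coeFn_smul t (isonormal b h)] with ω hω
  rw [hω]; simp

lemma map_isonormal (b : HilbertBasis ι ℝ H) (h : H) :
    (gaussianProduct ι).map (isonormal b h)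
      = gaussianReal 0 (.mk (‖h‖ ^ 2) (sq_nonneg _)) := by
  have := Measure.isProbabilityMeasure_map (aemeasurable_isonormal b h)
  refine Measure.ext_of_charFun (funext fun t => ?_)
  rw [charFun_map_isonormal, charFun_gaussianReal]
  congr 1
  simp
  ring

/-- By linearity the joint characteristic function at `t` is `exp(-‖∑ t k • v k‖ ^ 2 / 2)`, which
factors by Pythagoras. -/
lemma iIndepFun_isonormal (b : HilbertBasis ι ℝ H) {κ : Type*} {v : κ → H}
    (hv : Orthonormal ℝ v) : iIndepFun (fun k => ⇑(isonormal b (v k))) (gaussianProduct ι) := by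
  rw [iIndepFun_iff_finset]
  intro s
  have hm (k : s) := aemeasurable_isonormal b (v k)
  rw [iIndepFun_iff_charFun_pi (X := s.restrict fun k => ⇑(isonormal b (v k))) hm]
  intro t
  have h := integral_cexp_isonormal b (∑ k : s, t k • v k)
  have hv' : Orthonormal ℝ fun k : s => v k := hv.comp _ Subtype.val_injective
  rw [hv'.norm_sq_sum_smul] at h
  have hp : ∏ k : s, charFun ((gaussianProduct ι).map (isonormal b (v k))) (t k)
      = Complex.exp ((-((∑ k : s, t k ^ 2) / 2) : ℝ)) := by
    simp_rw [charFun_map_isonormal, hv.1]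
    rw [← Complex.exp_sum]
    congr 1
    push_cast
    rw [Finset.sum_div, ← Finset.sum_neg_distrib]
    refine Finset.sum_congr rfl fun k _ => ?_
    simp
  refine Eq.trans ?_ hp.symm
  have hX : AEMeasurable (fun ω => WithLp.toLp 2 fun k =>
      s.restrict (fun k => ⇑(isonormal b (v k))) k ω) (gaussianProduct ι) :=
    (PiLp.continuous_toLp 2 _).measurable.comp_aemeasurable (aemeasurable_pi_iff.2 hm)
  rw [← h, charFun_apply, integral_map hX (Continuous.aestronglyMeasurable (by fun_prop))]
  refine integral_congr_ae ?_
  rw [map_sum]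
  simp_rw [map_smul]
  have h1 : ∀ k : s, (t k • isonormal b (v k) : Lp ℝ 2 (gaussianProduct ι))
      =ᵐ[gaussianProduct ι] t k • ⇑(isonormal b (v k)) := fun k => Lp.coeFn_smul _ _
  filter_upwards [Lp.coeFn_finsetSum Finset.univ fun k : s => t k • isonormal b (v k),
    ae_all_iff.2 h1] with ω h2 h3
  rw [h2, Finset.sum_apply, PiLp.inner_apply]
  congr 3
  refine Finset.sum_congr rfl fun k _ => ?_
  rw [h3]
  simp

/-- Every orthonormal family indexed by `ι` has the same joint law under the isonormal process. -/
lemma exists_measurePreserving_isonormal (b : HilbertBasis ι ℝ H) {v : ι → H}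
    (hv : Orthonormal ℝ v) : ∃ Φ : (ι → ℝ) → ι → ℝ,
      MeasurePreserving Φ (gaussianProduct ι) (gaussianProduct ι) ∧
      ∀ i, isonormal b (v i) =ᵐ[gaussianProduct ι] fun ω => Φ ω i := by
  refine ⟨fun ω i => isonormal b (v i) ω, ⟨measurable_pi_iff.2 fun i =>
    (Lp.stronglyMeasurable _).measurable, ?_⟩, fun i => ae_eq_rfl⟩
  rw [(iIndepFun_isonormal b hv).map_fun_eq_infinitePi_map
    fun i => (Lp.stronglyMeasurable _).measurable]
  simp_rw [map_isonormal, hv.1]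
  congr 1
  ext1 i
  congr 1
  ext
  simp

end Gaussian

/-! ### Orthogonal operators acting on L_p. -/

section Representation

/-- Distinct members are at distance `√2`. Countability makes the Gaussian product standard Borel
and lets null sets be collected over all coordinates. -/
lemma Orthonormal.countable_index {ι H : Type*} [NormedAddCommGroup H] [InnerProductSpace ℝ H]
    [TopologicalSpace.SeparableSpace H] {v : ι → H} (hv : Orthonormal ℝ v) : Countable ι := by
  refine Pairwise.countable_of_isOpen_disjoint (s := fun i => Metric.ball (v i) (1 / 2))
    (fun i j hij => Metric.ball_disjoint_ball ?_) (fun i => Metric.isOpen_ball)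
    fun i => Metric.nonempty_ball.2 (by norm_num)
  have h : ‖v i - v j‖ ^ 2 = 2 := by
    rw [norm_sub_sq_real, hv.1, hv.1, hv.2 hij]; norm_num
  rw [dist_eq_norm]
  nlinarith [norm_nonneg (v i - v j)]

/-- An action of a group by linear isometries consists of linear isometric automorphisms. -/
lemma exists_linearIsometryEquiv_hom {𝕜 G X : Type*} [NormedField 𝕜] [Group G]
    [NormedAddCommGroup X] [NormedSpace 𝕜 X] (τ : G →* (X →ₗᵢ[𝕜] X)) :
    ∃ π : G →* (X ≃ₗᵢ[𝕜] X), ∀ g x, π g x = τ g x := by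
  have h (g : G) (x : X) : τ g (τ g⁻¹ x) = x := by
    change (τ g * τ g⁻¹) x = x
    rw [← map_mul, mul_inv_cancel, map_one]
    rfl
  refine ⟨⟨⟨fun g => LinearIsometryEquiv.ofSurjective (τ g) fun x => ⟨τ g⁻¹ x, h g x⟩, ?_⟩, ?_⟩,
    fun g x => rfl⟩
  · ext x
    exact congrFun (congrArg DFunLike.coe (map_one τ)) x
  · intro g g'
    ext x
    exact congrFun (congrArg DFunLike.coe (map_mul τ g g')) x

lemma compMeasurePreserving_congr_ae {α β E : Type*} [MeasurableSpace α] [MeasurableSpace β]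
    {μ : Measure α} {ν : Measure β} [NormedAddCommGroup E] {p : ℝ≥0∞} {f f' : α → β}
    (hf : MeasurePreserving f μ ν) (hf' : MeasurePreserving f' μ ν) (h : f =ᵐ[μ] f')
    (g : Lp E p ν) : Lp.compMeasurePreserving f hf g = Lp.compMeasurePreserving f' hf' g :=
  Subtype.ext (AEEqFun.compMeasurePreserving_congr _ hf hf'.measurable h)

/-- Mutually inverse measure preserving maps induce an isomorphism of `L^p` spaces. -/
lemma exists_linearIsometryEquiv_Lp (𝕜 : Type*) [RCLike 𝕜] {α β : Type*} [MeasurableSpace α]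
    [MeasurableSpace β] {μ : Measure α} {ν : Measure β} (p : ℝ≥0∞) [Fact (1 ≤ p)]
    {Φ : α → β} {Ψ : β → α} (hΦ : MeasurePreserving Φ μ ν) (hΨ : MeasurePreserving Ψ ν μ)
    (h : Φ ∘ Ψ =ᵐ[ν] id) : Nonempty (Lp 𝕜 p μ ≃ₗᵢ[𝕜] Lp 𝕜 p ν) := by
  refine ⟨LinearIsometryEquiv.ofSurjective (Lp.compMeasurePreservingₗᵢ 𝕜 Ψ hΨ) fun g =>
    ⟨Lp.compMeasurePreserving Φ hΦ g, ?_⟩⟩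
  change Lp.compMeasurePreserving Ψ hΨ (Lp.compMeasurePreserving Φ hΦ g) = g
  rw [← Lp.compMeasurePreserving_comp_apply,
    compMeasurePreserving_congr_ae _ (MeasurePreserving.id ν) h, Lp.compMeasurePreserving_id_apply]

variable {ι : Type*} {H : Type*} [NormedAddCommGroup H] [InnerProductSpace ℝ H]
  (b : HilbertBasis ι ℝ H)

/-- Orthogonal operators act on the Gaussian product by measure preserving maps. -/
noncomputable def secondQuantization (U : H ≃ₗᵢ[ℝ] H) : (ι → ℝ) → ι → ℝ :=
  (exists_measurePreserving_isonormal b (b.orthonormal.comp_linearIsometryEquiv U)).choose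

lemma measurePreserving_secondQuantization (U : H ≃ₗᵢ[ℝ] H) :
    MeasurePreserving (secondQuantization b U) (gaussianProduct ι) (gaussianProduct ι) :=
  (exists_measurePreserving_isonormal b
    (b.orthonormal.comp_linearIsometryEquiv U)).choose_spec.1

lemma isonormal_map_basis (U : H ≃ₗᵢ[ℝ] H) (i : ι) :
    isonormal b (U (b i)) =ᵐ[gaussianProduct ι] fun ω => secondQuantization b U ω i :=
  (exists_measurePreserving_isonormal b
    (b.orthonormal.comp_linearIsometryEquiv U)).choose_spec.2 i

/-- Both sides are continuous and linear in `h`, and they agree on the basis by the choice of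
`secondQuantization`. -/
lemma compMeasurePreserving_isonormal (U : H ≃ₗᵢ[ℝ] H) (h : H) :
    Lp.compMeasurePreserving _ (measurePreserving_secondQuantization b U) (isonormal b h)
      = isonormal b (U h) := by
  set A : H →L[ℝ] Lp ℝ 2 (gaussianProduct ι) := ((Lp.compMeasurePreservingₗᵢ ℝ _
    (measurePreserving_secondQuantization b U)).comp (isonormal b)).toContinuousLinearMap
  set B : H →L[ℝ] Lp ℝ 2 (gaussianProduct ι) :=
    ((isonormal b).comp U.toLinearIsometry).toContinuousLinearMap
  have hAB : A = B := by
    refine ContinuousLinearMap.ext_on (s := range b)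
      (Submodule.dense_iff_topologicalClosure_eq_top.2 b.dense_span) ?_
    rintro _ ⟨i, rfl⟩
    change Lp.compMeasurePreserving _ (measurePreserving_secondQuantization b U)
      (isonormal b (b i)) = isonormal b (U (b i))
    rw [isonormal_basis]
    refine Lp.ext ?_
    filter_upwards [Lp.coeFn_compMeasurePreserving (gaussianCoord i)
      (measurePreserving_secondQuantization b U), isonormal_map_basis b U i,
      (measurePreserving_secondQuantization b U).quasiMeasurePreserving.ae_eq_comp
        (coeFn_gaussianCoord i)] with ω h1 h2 h3
    rw [h1, h2, h3]
    rfl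
  exact congrFun (congrArg DFunLike.coe hAB) h

lemma isonormal_comp_secondQuantization (U : H ≃ₗᵢ[ℝ] H) (h : H) :
    ⇑(isonormal b h) ∘ secondQuantization b U =ᵐ[gaussianProduct ι] isonormal b (U h) := by
  rw [← compMeasurePreserving_isonormal]
  exact (Lp.coeFn_compMeasurePreserving _ _).symm

section Action

variable [Countable ι]

lemma secondQuantization_one :
    secondQuantization b 1 =ᵐ[gaussianProduct ι] id := by
  filter_upwards [ae_all_iff.2 (isonormal_map_basis b 1),
    ae_all_iff.2 (coeFn_gaussianCoord (ι := ι))] with ω h1 h2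
  funext i
  rw [← h1, LinearIsometryEquiv.coe_one, id, isonormal_basis, h2, id]

/-- The order is reversed on points, so that precomposition becomes a homomorphism. The maps are
chosen separately for each operator, so the identity holds only almost everywhere, which is enough
on L_p. -/
lemma secondQuantization_comp (U V : H ≃ₗᵢ[ℝ] H) :
    secondQuantization b V ∘ secondQuantization b U
      =ᵐ[gaussianProduct ι] secondQuantization b (U * V) := by
  have h1 := ae_all_iff.2 fun i => isonormal_comp_secondQuantization b U (V (b i))
  have h2 := ae_all_iff.2 fun i => (measurePreserving_secondQuantization b
    U).quasiMeasurePreserving.ae_eq_comp (isonormal_map_basis b V i)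
  filter_upwards [h1, h2, ae_all_iff.2 (isonormal_map_basis b (U * V))] with ω h1 h2 h3
  funext i
  rw [← h3 i]
  exact (h2 i).symm.trans (h1 i)

/-- The action of the orthogonal group on the `L^p` space of the Gaussian product. -/
noncomputable def gaussianAction (𝕜 : Type*) [RCLike 𝕜] (p : ℝ≥0∞) [Fact (1 ≤ p)] :
    (H ≃ₗᵢ[ℝ] H) →* (Lp 𝕜 p (gaussianProduct ι) →ₗᵢ[𝕜] Lp 𝕜 p (gaussianProduct ι)) where
  toFun U := Lp.compMeasurePreservingₗᵢ 𝕜 _ (measurePreserving_secondQuantization b U)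
  map_one' := by
    refine LinearIsometry.ext fun g => ?_
    change Lp.compMeasurePreserving _ _ g = g
    rw [compMeasurePreserving_congr_ae _ (MeasurePreserving.id _) (secondQuantization_one b),
      Lp.compMeasurePreserving_id_apply]
  map_mul' U V := by
    refine LinearIsometry.ext fun g => ?_
    change Lp.compMeasurePreserving _ _ g =
      Lp.compMeasurePreserving _ _ (Lp.compMeasurePreserving _ _ g)
    rw [← Lp.compMeasurePreserving_comp_apply]
    exact compMeasurePreserving_congr_ae _ _ (secondQuantization_comp b U V).symm g

end Action

/-- The variable at `h` has the law of `‖h‖` times a standard Gaussian. -/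
lemma eLpNorm_isonormal (p : ℝ≥0∞) (h : H) :
    eLpNorm (isonormal b h) p (gaussianProduct ι)
      = ‖h‖ₑ * eLpNorm id p (gaussianReal 0 1) := by
  have h1 := eLpNorm_map_measure (p := p) (g := (id : ℝ → ℝ)) aestronglyMeasurable_id
    (aemeasurable_isonormal b h)
  have h2 := gaussianReal_map_const_mul (μ := 0) (v := 1) ‖h‖
  rw [mul_zero, mul_one] at h2
  have h3 := eLpNorm_map_measure (p := p) (μ := gaussianReal 0 1) (f := fun x => ‖h‖ * x)
    (g := (id : ℝ → ℝ)) aestronglyMeasurable_id (by fun_prop)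
  rw [Function.id_comp] at h1 h3
  rw [← h1, map_isonormal, ← h2, h3]
  have h4 := eLpNorm_const_smul ‖h‖ (id : ℝ → ℝ) p (gaussianReal 0 1)
  rw [enorm_norm] at h4
  exact h4

lemma memLp_isonormal {p : ℝ≥0∞} (hp : p ≠ ∞) (h : H) :
    MemLp (isonormal b h) p (gaussianProduct ι) :=
  ⟨(Lp.stronglyMeasurable _).aestronglyMeasurable, by
    rw [eLpNorm_isonormal]
    exact ENNReal.mul_lt_top enorm_lt_top (memLp_id_gaussianReal' p hp).2⟩

lemma eLpNorm_id_gaussianReal_ne_zero {p : ℝ≥0∞} (hp : p ≠ 0) :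
    eLpNorm id p (gaussianReal 0 1) ≠ 0 := by
  have := nullSingletonClass_gaussianReal (μ := 0) (v := 1) one_ne_zero
  intro h
  rw [eLpNorm_eq_zero_iff aestronglyMeasurable_id hp] at h
  have h0 : gaussianReal 0 1 {(0 : ℝ)}ᶜ = 0 := h
  rw [prob_compl_eq_zero_iff (measurableSet_singleton _), measure_singleton] at h0
  exact zero_ne_one h0

/-- The isonormal process, with values in an `L^p` space of `𝕜`-valued functions. -/
noncomputable def isonormalLp (𝕜 : Type*) [RCLike 𝕜] {p : ℝ≥0∞} (hp : p ≠ ∞) :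
    H →+ Lp 𝕜 p (gaussianProduct ι) where
  toFun h := (memLp_isonormal b hp h).ofReal (K := 𝕜).toLp _
  map_zero' := by
    refine Lp.ext ?_
    filter_upwards [MemLp.coeFn_toLp ((memLp_isonormal b hp 0).ofReal (K := 𝕜)),
      Lp.coeFn_zero 𝕜 p (gaussianProduct ι), Lp.coeFn_zero ℝ 2 (gaussianProduct ι)] with ω h1 h2 h3
    rw [h1, h2, map_zero, h3]
    simp
  map_add' h h' := by
    refine Lp.ext ?_
    refine (MemLp.coeFn_toLp _).trans (EventuallyEq.trans ?_ (Lp.coeFn_add _ _).symm)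
    filter_upwards [MemLp.coeFn_toLp ((memLp_isonormal b hp h).ofReal (K := 𝕜)),
      MemLp.coeFn_toLp ((memLp_isonormal b hp h').ofReal (K := 𝕜)),
      Lp.coeFn_add (isonormal b h) (isonormal b h')] with ω h1 h2 h3
    rw [Pi.add_apply, h1, h2, map_add, h3]
    simp

lemma norm_isonormalLp (𝕜 : Type*) [RCLike 𝕜] {p : ℝ≥0∞} (hp : p ≠ ∞) (h : H) :
    ‖isonormalLp b 𝕜 hp h‖ = (eLpNorm id p (gaussianReal 0 1)).toReal * ‖h‖ := by
  change ‖MemLp.toLp _ ((memLp_isonormal b hp h).ofReal (K := 𝕜))‖ = _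
  rw [Lp.norm_toLp, eLpNorm_congr_norm_ae (g := isonormal b h)
    (ae_of_all _ fun ω => RCLike.norm_ofReal _), eLpNorm_isonormal, ENNReal.toReal_mul, mul_comm,
    toReal_enorm]

lemma gaussianAction_isonormalLp [Countable ι] (𝕜 : Type*) [RCLike 𝕜] {p : ℝ≥0∞} [Fact (1 ≤ p)]
    (hp : p ≠ ∞) (U : H ≃ₗᵢ[ℝ] H) (h : H) :
    gaussianAction b 𝕜 p U (isonormalLp b 𝕜 hp h) = isonormalLp b 𝕜 hp (U h) := by
  change Lp.compMeasurePreserving _ (measurePreserving_secondQuantization b U)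
    (MemLp.toLp _ ((memLp_isonormal b hp h).ofReal (K := 𝕜)))
      = MemLp.toLp _ ((memLp_isonormal b hp (U h)).ofReal (K := 𝕜))
  rw [Lp.toLp_compMeasurePreserving, MemLp.toLp_eq_toLp_iff]
  filter_upwards [isonormal_comp_secondQuantization b U h] with ω hω
  exact congrArg _ hω

/-- Up to scaling, the orthogonal representation of the full orthogonal group on a separable real
Hilbert space embeds into an isometric representation on `L^p([0, 1])`. -/
theorem exists_orthogonal_representation_Lp [CompleteSpace H] [TopologicalSpace.SeparableSpace H]
    [Nontrivial H] (𝕜 : Type*) [RCLike 𝕜] {p : ℝ≥0∞} [Fact (1 ≤ p)] (hp : p ≠ ∞) :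
    ∃ (c : ℝ) (T : H →+ Lp 𝕜 p (volume : Measure I))
      (ρ : (H ≃ₗᵢ[ℝ] H) →* (Lp 𝕜 p (volume : Measure I) ≃ₗᵢ[𝕜] Lp 𝕜 p (volume : Measure I))),
      0 < c ∧ (∀ h, ‖T h‖ = c * ‖h‖) ∧ ∀ U h, ρ U (T h) = T (U h) := by
  obtain ⟨w, b, -⟩ := exists_hilbertBasis ℝ H
  have hc : Countable w := b.orthonormal.countable_index
  have hne : Nonempty w := by
    by_contra hw
    rw [not_nonempty_iff] at hw
    obtain ⟨x, hx⟩ := exists_ne (0 : H)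
    refine hx (b.repr.injective ?_)
    ext i
    exact hw.elim i
  have := nullSingletonClass_gaussianProduct (ι := w)
  obtain ⟨Φ, Ψ, hΦ, hΨ, -, h⟩ := exists_measurePreserving_unitInterval (gaussianProduct w)
  obtain ⟨E⟩ := exists_linearIsometryEquiv_Lp 𝕜 p hΦ hΨ h
  obtain ⟨π, hπ⟩ := exists_linearIsometryEquiv_hom (gaussianAction b 𝕜 p)
  refine ⟨_, (E : _ →+ Lp 𝕜 p (volume : Measure I)).comp (isonormalLp b 𝕜 hp),
    ⟨⟨fun U => E.symm.trans ((π U).trans E), ?_⟩, ?_⟩, ENNReal.toReal_pos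
      (eLpNorm_id_gaussianReal_ne_zero (one_pos.trans_le Fact.out).ne')
      (memLp_id_gaussianReal' p hp).2.ne, fun h => ?_, fun U h => ?_⟩
  · ext1 x
    simp
  · intro U V
    ext1 x
    simp
  · exact (E.norm_map _).trans (norm_isonormalLp b 𝕜 hp h)
  · change E (π U (E.symm (E (isonormalLp b 𝕜 hp h)))) = E (isonormalLp b 𝕜 hp (U h))
    rw [E.symm_apply_apply, hπ, gaussianAction_isonormalLp]

end Representation

/-! ### Transfer of equivariant maps and the comparison of exponents. -/

/-- A linear isometric automorphism of a Hilbert space over `𝕜`, as an orthogonal operator of the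
underlying real Hilbert space. -/
noncomputable def orthogonalOfUnitary (𝕜 H : Type*) [RCLike 𝕜] [NormedAddCommGroup H]
    [InnerProductSpace 𝕜 H] :
    letI := InnerProductSpace.rclikeToReal 𝕜 H
    (H ≃ₗᵢ[𝕜] H) →* (H ≃ₗᵢ[ℝ] H) :=
  letI := InnerProductSpace.rclikeToReal 𝕜 H
  { toFun := fun U =>
      { toFun := U
        invFun := U.symm
        left_inv := U.symm_apply_apply
        right_inv := U.apply_symm_apply
        map_add' := map_add U
        map_smul' := fun r x => U.map_smul (r : 𝕜) x
        norm_map' := U.norm_map }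
    map_one' := rfl
    map_mul' := fun _ _ => rfl }

/-- An equivariant map into a separable Hilbert space yields an equivariant map into
`L^p([0, 1])` with proportional distances. -/
theorem exists_isEquivariantMap_Lp {𝕜 G H : Type*} [RCLike 𝕜] [Group G] [NormedAddCommGroup H]
    [InnerProductSpace 𝕜 H] [CompleteSpace H] [TopologicalSpace.SeparableSpace H] [Nontrivial H]
    {p : ℝ≥0∞} [Fact (1 ≤ p)] (hp : p ≠ ∞) {ψ : G → H} (hψ : IsEquivariantMap 𝕜 ψ) :
    ∃ (c : ℝ) (φ : G → Lp 𝕜 p (volume : Measure I)), 0 < c ∧ IsEquivariantMap 𝕜 φ ∧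
      ∀ x y, ‖φ x - φ y‖ = c * ‖ψ x - ψ y‖ := by
  let := InnerProductSpace.rclikeToReal 𝕜 H
  obtain ⟨c, T, ρ, hc, hT, hρ⟩ := exists_orthogonal_representation_Lp (H := H) 𝕜 hp
  obtain ⟨π, f, v, hf, hψ⟩ := hψ
  have hπ (x : G) (h : H) : ρ (orthogonalOfUnitary 𝕜 H (π x)) (T h) = T (π x h) := hρ _ h
  refine ⟨c, T ∘ ψ, hc, ⟨ρ.comp ((orthogonalOfUnitary 𝕜 H).comp π), T ∘ f, T v, ?_, ?_⟩, ?_⟩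
  · intro x y
    change T (f (x * y)) = ρ (orthogonalOfUnitary 𝕜 H (π x)) (T (f y)) + T (f x)
    rw [hπ, hf, map_add]
  · intro x
    change T (ψ x) = ρ (orthogonalOfUnitary 𝕜 H (π x)) (T v) + T (f x)
    rw [hπ, hψ, map_add]
  · intro x y
    rw [← hT, map_sub]
    rfl

lemma HasCompression.of_norm_eq {G X Y : Type*} [Group G] {S : Set G} [NormedAddCommGroup X]
    [NormedAddCommGroup Y] {ψ : G → X} {φ : G → Y} {α : ℝ≥0} (h : HasCompression S ψ α) {c : ℝ}
    (hc : 0 < c) (hφ : ∀ x y, ‖φ x - φ y‖ = c * ‖ψ x - ψ y‖) : HasCompression S φ α := by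
  obtain ⟨⟨L, hL⟩, d, hd, hlow⟩ := h
  refine ⟨⟨c * L, fun x y => ?_⟩, c * d, mul_pos hc hd, fun x y hxy => ?_⟩
  · rw [hφ, mul_assoc]
    exact mul_le_mul_of_nonneg_left (hL x y) hc.le
  · rw [hφ, mul_assoc]
    exact mul_le_mul_of_nonneg_left (hlow x y hxy) hc.le

/-- Needed because the Gaussian product over an empty basis is a point mass, which has an atom. -/
lemma nontrivial_Lp_unitInterval (𝕜 : Type*) [RCLike 𝕜] (p : ℝ≥0∞) [Fact (1 ≤ p)] :
    Nontrivial (Lp 𝕜 p (volume : Measure I)) := by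
  refine ⟨⟨Lp.const p volume 1, 0, fun h => ?_⟩⟩
  have h1 := Lp.norm_const (p := p) (μ := (volume : Measure I)) (c := (1 : 𝕜))
    (one_pos.trans_le Fact.out).ne'
  rw [h] at h1
  simp at h1

theorem lemma2p4 (𝕜 : Type*) [RCLike 𝕜] {G : Type*} [Group G]
    (S : Set G) (hfin : S.Finite) (hsymm : ∀ s : G, s ∈ S ↔ s⁻¹ ∈ S)
    (hgen : Subgroup.closure S = ⊤)
    (p : ℝ≥0∞) [Fact (1 ≤ p)] (hp : p ≠ ∞) :
    lpEquivariantCompressionExponent 𝕜 S 2 ≤ lpEquivariantCompressionExponent 𝕜 S p := by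
  have := nontrivial_Lp_unitInterval 𝕜 2
  -- Finiteness of the exponent enters the instance that makes L_2 separable.
  have : Fact ((2 : ℝ≥0∞) ≠ ∞) := ⟨ENNReal.ofNat_ne_top⟩
  refine biSup_mono fun α => ?_
  rintro ⟨ψ, hψ, hα⟩
  obtain ⟨c, φ, hc, hφ, h⟩ := exists_isEquivariantMap_Lp hp hψ
  exact ⟨φ, hφ, hα.of_norm_eq hc h⟩
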